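/- Fix $c\in\mathbb{R}$. For $1\le p<\infty$ let $X^p_c$ be the space of functions $f:\mathbb{R}^+\to\mathbb{C}$ with $u\mapsto u^{c-1/p}f(u)\in L^p(\mathbb{R}^+)$, and put $\|f\|_{X^\infty_c}=\sup_{x>0}|x^cf(x)|$. For $f\in X^2_c$ the Mellin transform $v\mapsto[f]^\wedge_{M_c}(c+iv)$ is the limit in $L^2(\mathbb{R})$, as $\rho\to\infty$, of $v\mapsto\int_{1/\rho}^{\rho}f(u)u^{c+iv-1}\,du$. Let $\mathcal{M}^2_c$ be the space of continuous $f\in X^2_c$ whose Mellin transform is integrable over the line $\{c\}\times i\mathbb{R}$, and, for $\sigma>0$, let $B^2_{c,\sigma}$ be the space of continuous $f\in X^2_c$ with $[f]^\wedge_{M_c}(c+iv)=0$ for (almost) all $|v|>\sigma$. Let $G^1_c$ be the space of functions of the form $f(x)=\frac1{2\pi}\int_{\mathbb{R}}\varphi(v)x^{-c-iv}\,dv$ $(x>0)$ with $\varphi\in L^1(\mathbb{R})$; here $\varphi$ is unique up to a null set, and $[\!|f|\!]_1:=\|\varphi\|_{L^1(\mathbb{R})}$. For $f\in G^1_c$ put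 $\operatorname{dist}_1(f,B^2_{c,\sigma})=\inf_{g\in B^2_{c,\sigma}}[\!|f-g|\!]_1$. The Mellin derivative is $\Theta_cf(x)=\lim_{h\to1}\frac{h^cf(hx)-f(x)}{h-1}$. **Theorem.** Let $f\in\mathcal{M}^2_c$ and suppose that $v\mapsto v\,[f]^\wedge_{M_c}(c+iv)$ is absolutely integrable on $\mathbb{R}$. Then, for every $T>0$ and $x>0$, the Mellin derivative $\Theta_cf(x)$ exists, the following series converges absolutely, and, defining $(R^B_{\pi T}f)(x)$ by $$\Theta_cf(x)=\frac{4T}{\pi}\sum_{k\in\mathbb{Z}}\frac{(-1)^{k+1}}{(2k-1)^2}\,e^{(k-1/2)c/T}f\bigl(xe^{(k-1/2)/T}\bigr)+(R^B_{\pi T}f)(x),$$ one has $$(R^B_{\pi T}f)(x)=\frac1{2\pi i}\int_{|v|\ge\pi T}\Bigl[v-\pi T\,\phi\Bigl(\frac v{\pi T}\Bigr)\Bigr][f]^\wedge_{M_c}(c+iv)\,x^{-c-iv}\,dv,\qquad \phi(v):=\Bigl|v+1-4\Bigl\lfloor\frac{v+3}4\Bigr\rfloor\Bigr|-1,$$ both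 this integral and the next one being absolutely convergent. In particular, $$|(R^B_{\pi T}f)(x)|\le\frac{x^{-c}}{2\pi}\int_{|v|\ge\pi T}(|v|+\pi T)\,\bigl|[f]^\wedge_{M_c}(c+iv)\bigr|\,dv .$$ Moreover $\Theta_cf\in G^1_c$, the distance $\operatorname{dist}_1(\Theta_cf,B^2_{c,\pi T})$ is finite, and $$\|R^B_{\pi T}f\|_{X^\infty_c}\le\frac1\pi\operatorname{dist}_1\bigl(\Theta_cf,B^2_{c,\pi T}\bigr).$$ -/

import Mathlib

open MeasureTheory Filter Topology
open scoped ENNReal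

noncomputable section

namespace MellinBoas

/-! Functions on `ℝ⁺` are represented by functions on `ℝ` of which only the values at `x > 0` matter,
functions on the line `{c} × iℝ` by functions of the ordinate `v : ℝ`. -/

/-- `f ∈ X²_c`, that is, `u ↦ u ^ (c - 1/2) f(u)` belongs to `L²(ℝ⁺)`. -/
def MemX2 (c : ℝ) (f : ℝ → ℂ) : Prop :=
  MemLp (fun u : ℝ => ((u ^ (c - 1 / 2) : ℝ) : ℂ) * f u) 2 (volume.restrict (Set.Ioi 0))

/-- The norm of `X^∞_c`: `sup_{x > 0} |x ^ c f(x)|`, with values in `[0, ∞]`. -/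
def normXInfty (c : ℝ) (f : ℝ → ℂ) : ℝ≥0∞ :=
  ⨆ x : Set.Ioi (0 : ℝ), ‖(((x : ℝ) ^ c : ℝ) : ℂ) * f x‖ₑ

/-- The truncated Mellin integral `∫_{1/ρ}^ρ f(u) u ^ (c + it - 1) du`. -/
def truncatedMellin (c : ℝ) (f : ℝ → ℂ) (ρ t : ℝ) : ℂ :=
  ∫ u in (1 / ρ)..ρ, f u * (u : ℂ) ^ ((c : ℂ) + Complex.I * (t : ℂ) - 1)

/-- `g ∈ L²(ℝ)` is the limit in `L²`-mean of the truncated Mellin integrals of `f`, as `ρ → ∞`. -/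
def IsMellinTransform (c : ℝ) (f g : ℝ → ℂ) : Prop :=
  MemLp g 2 volume ∧
    Tendsto (fun ρ : ℝ => eLpNorm (fun t => g t - truncatedMellin c f ρ t) 2 volume) atTop (𝓝 0)

/-- The Mellin transform `v ↦ [f]^∧(c + iv)` of `f ∈ X²_c`: a function that is the limit in
`L²`-mean of the truncated Mellin integrals. It is determined up to a null set. -/
def mellinTransform (c : ℝ) (f : ℝ → ℂ) : ℝ → ℂ :=
  Classical.epsilon (IsMellinTransform c f)

/-- The Mellin inversion class `M²_c`: continuous `f ∈ X²_c` with integrable Mellin transform. -/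
def MemM2 (c : ℝ) (f : ℝ → ℂ) : Prop :=
  MemX2 c f ∧ ContinuousOn f (Set.Ioi 0) ∧ Integrable (mellinTransform c f)

/-- The Mellin–Bernstein space `B²_{c,σ}`: continuous `f ∈ X²_c` whose Mellin transform vanishes
outside `[-σ, σ]`. -/
def MemB2 (c σ : ℝ) (f : ℝ → ℂ) : Prop :=
  MemX2 c f ∧ ContinuousOn f (Set.Ioi 0) ∧ ∀ᵐ v : ℝ, σ < |v| → mellinTransform c f v = 0

/-- `φ ∈ L¹ ∩ L^q` represents `f`: `f(x) = (1/2π) ∫ φ(v) x ^ (-c - iv) dv` for all `x > 0`. -/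
def Represents (q : ℝ≥0∞) (c : ℝ) (f φ : ℝ → ℂ) : Prop :=
  Integrable φ ∧ MemLp φ q volume ∧
    ∀ x : ℝ, 0 < x → f x = 1 / (2 * (Real.pi : ℂ)) *
      ∫ v : ℝ, φ v * (x : ℂ) ^ (-(c : ℂ) - Complex.I * (v : ℂ))

/-- The space `G^q_c`. -/
def MemG (q : ℝ≥0∞) (c : ℝ) (f : ℝ → ℂ) : Prop :=
  ∃ φ : ℝ → ℂ, Represents q c f φ

/-- The norm of `G^q_c`: the `L^q` norm of the function `φ` that represents `f` (`φ` is unique up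
to a null set, so the infimum is over a single value); it is `∞` outside `G^q_c`. -/
def normG (q : ℝ≥0∞) (c : ℝ) (f : ℝ → ℂ) : ℝ≥0∞ :=
  ⨅ (φ : ℝ → ℂ) (_ : Represents q c f φ), eLpNorm φ q volume

/-- `dist_q(f, B²_{c,σ})`. -/
def distB2 (q : ℝ≥0∞) (c σ : ℝ) (f : ℝ → ℂ) : ℝ≥0∞ :=
  ⨅ (g : ℝ → ℂ) (_ : MemB2 c σ g), normG q c (f - g)

/-- The difference quotient `(h ^ c f(hx) - f(x)) / (h - 1)`. -/
def mellinQuotient (c : ℝ) (f : ℝ → ℂ) (x h : ℝ) : ℂ :=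
  (((h ^ c : ℝ) : ℂ) * f (h * x) - f x) / ((h : ℂ) - 1)

/-- The Mellin derivative of `f` at `x` exists and equals `d`. -/
def HasMellinDeriv (c : ℝ) (f : ℝ → ℂ) (x : ℝ) (d : ℂ) : Prop :=
  Tendsto (mellinQuotient c f x) (𝓝[≠] 1) (𝓝 d)

/-- The first Mellin derivative `Θ_c f`. -/
def mellinDeriv (c : ℝ) (f : ℝ → ℂ) (x : ℝ) : ℂ :=
  limUnder (𝓝[≠] (1 : ℝ)) (mellinQuotient c f x)

/-- The `k`-th term `(-1)^{k+1} / (2k-1)² · e^{(k-1/2)c/T} f(x e^{(k-1/2)/T})`. -/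
def boasTerm (c T : ℝ) (f : ℝ → ℂ) (x : ℝ) (k : ℤ) : ℂ :=
  (((-1 : ℝ) ^ (k + 1) / (2 * (k : ℝ) - 1) ^ 2 *
      Real.exp (((k : ℝ) - 1 / 2) * c / T) : ℝ) : ℂ) *
    f (x * Real.exp (((k : ℝ) - 1 / 2) / T))

/-- The remainder `R^B_{πT} f` of the Mellin–Boas formula: the deviation of the series from
`Θ_c f`. -/
def boasRemainder (c T : ℝ) (f : ℝ → ℂ) (x : ℝ) : ℂ :=
  mellinDeriv c f x - ((4 * T / Real.pi : ℝ) : ℂ) * ∑' k : ℤ, boasTerm c T f x k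

/-- The triangle wave `φ(v) = |v + 1 - 4⌊(v + 3)/4⌋| - 1`. -/
def triangleWave (v : ℝ) : ℝ :=
  |v + 1 - 4 * (⌊(v + 3) / 4⌋ : ℝ)| - 1

/-- The integrand `[v - πT φ(v/(πT))] [f]^∧(c + iv) x ^ (-c - iv)`. -/
def remainderIntegrand (c T : ℝ) (f : ℝ → ℂ) (x v : ℝ) : ℂ :=
  ((v - Real.pi * T * triangleWave (v / (Real.pi * T)) : ℝ) : ℂ) *
    mellinTransform c f v * (x : ℂ) ^ (-(c : ℂ) - Complex.I * (v : ℂ))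

end MellinBoas

end

open MellinBoas

/-! ### Fourier integrals and the `L²`-Fourier transform -/

section Fourier

open FourierTransform SchwartzMap

/-! All terms of the formula are Fourier multipliers. With `F(t) = e^{ct} f(e^t)` (`logLift`), the
Mellin transform `φ` of `f` is the inverse Fourier transform of `F`, rescaled by `2π`, and inversion
gives `f(x) = (1/2π) ∫ φ(v) x^{-c-iv} dv` (`represents_mellinTransform`). On `φ` the Mellin
derivative acts as `-iv` (`hasMellinDeriv_of_represents`), and the weighted dilation by
`e^{(k-1/2)/T}` as `e^{-iv(k-1/2)/T}`. The Boas coefficients are the Fourier coefficients of the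
triangle wave (`hasSum_triangleWave`), so the series, with its factor `4T/π`, acts as `-iπT` times
the wave at `v/(πT)` (`hasSum_boasTerm`).

The wave is the identity on `[-1, 1]`, so the difference of the multipliers vanishes for `|v| ≤ πT`.
Elsewhere it is at most `|v| + πT ≤ 2|v|`. Elements of `B²_{c,πT}` cannot alter the representing
function outside the band, so the integral of `|v φ(v)|` there is at most the distance
(`setLIntegral_enorm_le_distB2`). -/

theorem ae_eq_of_forall_integral_schwartz_mul_eq {f g : ℝ → ℂ} (hf : LocallyIntegrable f)
    (hg : LocallyIntegrable g)
    (h : ∀ ψ : 𝓢(ℝ, ℂ), ∫ x, ψ x * f x = ∫ x, ψ x * g x) : f =ᵐ[volume] g := by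
  refine ae_eq_of_integral_contDiff_smul_eq hf hg fun θ θ_smooth θ_cpt => ?_
  have h₁ : HasCompactSupport (Complex.ofRealCLM ∘ θ) := θ_cpt.comp_left rfl
  have h₂ : ContDiff ℝ (⊤ : ℕ∞) (Complex.ofRealCLM ∘ θ) := by fun_prop
  simpa using h (h₁.toSchwartzMap h₂)

theorem integral_schwartz_fourier_mul_eq {h : ℝ → ℂ} (hh : Integrable h) (ψ : 𝓢(ℝ, ℂ)) :
    ∫ x, (𝓕 ψ) x * h x = ∫ x, ψ x * 𝓕 h x := by
  have := VectorFourier.integral_fourierIntegral_smul_eq_flip (L := innerₗ ℝ)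
    Real.continuous_fourierChar continuous_inner (ψ.integrable (μ := volume)) hh
  rw [flip_innerₗ] at this
  simp only [SchwartzMap.fourier_coe]
  exact this

theorem integral_schwartz_fourierInv_mul_eq {h : ℝ → ℂ} (hh : Integrable h) (ψ : 𝓢(ℝ, ℂ)) :
    ∫ x, (𝓕⁻ ψ) x * h x = ∫ x, ψ x * 𝓕⁻ h x := by
  have key := integral_schwartz_fourier_mul_eq hh.comp_neg ψ
  rw [← integral_neg_eq_self] at key
  simp only [SchwartzMap.fourier_coe, neg_neg] at key
  simp only [SchwartzMap.fourierInv_coe, Real.fourierInv_eq_fourier_neg]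
  rw [key]
  congr 1 with x
  rw [← Real.fourierInv_eq_fourier_neg, Real.fourierInv_eq_fourier_comp_neg]

theorem continuous_fourier_of_integrable {h : ℝ → ℂ} (hh : Integrable h) : Continuous (𝓕 h) :=
  VectorFourier.fourierIntegral_continuous Real.continuous_fourierChar
    (L := innerₗ ℝ) continuous_inner hh

theorem continuous_fourierInv_of_integrable {h : ℝ → ℂ} (hh : Integrable h) :
    Continuous (𝓕⁻ h) := by
  rw [Real.fourierInv_eq_fourier_comp_neg]
  exact continuous_fourier_of_integrable hh.comp_neg

/-- On `L¹ ∩ L²` the `L²`-Fourier transform is given by the Fourier integral. -/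
theorem coeFn_fourier_toLp {h : ℝ → ℂ} (h₁ : Integrable h) (h₂ : MemLp h 2) :
    (𝓕 h₂.toLp : Lp ℂ 2 (volume : Measure ℝ)) =ᵐ[volume] 𝓕 h := by
  refine ae_eq_of_forall_integral_schwartz_mul_eq ((Lp.memLp _).locallyIntegrable (by norm_num))
    (continuous_fourier_of_integrable h₁).locallyIntegrable fun ψ => ?_
  have key := DFunLike.congr_fun (Lp.fourier_toTemperedDistribution_eq h₂.toLp) ψ
  rw [TemperedDistribution.fourier_apply, Lp.toTemperedDistribution_apply,
    Lp.toTemperedDistribution_apply] at key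
  simp only [smul_eq_mul] at key
  rw [← key, ← integral_schwartz_fourier_mul_eq h₁ ψ]
  refine integral_congr_ae ?_
  filter_upwards [h₂.coeFn_toLp] with x hx
  rw [hx]

/-- On `L¹ ∩ L²` the inverse `L²`-Fourier transform is given by the inverse Fourier integral. -/
theorem coeFn_fourierInv_toLp {h : ℝ → ℂ} (h₁ : Integrable h) (h₂ : MemLp h 2) :
    (𝓕⁻ h₂.toLp : Lp ℂ 2 (volume : Measure ℝ)) =ᵐ[volume] 𝓕⁻ h := by
  refine ae_eq_of_forall_integral_schwartz_mul_eq ((Lp.memLp _).locallyIntegrable (by norm_num))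
    (continuous_fourierInv_of_integrable h₁).locallyIntegrable fun ψ => ?_
  have key := DFunLike.congr_fun (Lp.fourierInv_toTemperedDistribution_eq h₂.toLp) ψ
  rw [TemperedDistribution.fourierInv_apply, Lp.toTemperedDistribution_apply,
    Lp.toTemperedDistribution_apply] at key
  simp only [smul_eq_mul] at key
  rw [← key, ← integral_schwartz_fourierInv_mul_eq h₁ ψ]
  refine integral_congr_ae ?_
  filter_upwards [h₂.coeFn_toLp] with x hx
  rw [hx]

/-- Every Schwartz function is a Fourier transform, so the multiplication formula gives injectivity
on `L¹` without integrability of the transforms. -/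
theorem ae_eq_of_fourier_eq {g h : ℝ → ℂ} (hg : Integrable g) (hh : Integrable h)
    (e : ∀ x, 𝓕 g x = 𝓕 h x) : g =ᵐ[volume] h := by
  refine ae_eq_of_forall_integral_schwartz_mul_eq hg.locallyIntegrable hh.locallyIntegrable
    fun ψ => ?_
  have hψ : 𝓕 (𝓕⁻ ψ) = ψ := fourier_fourierInv_eq ψ
  rw [← hψ, integral_schwartz_fourier_mul_eq hg, integral_schwartz_fourier_mul_eq hh]
  simp only [e]

/-- A continuous square integrable function whose inverse `L²`-Fourier transform is integrable is
the Fourier integral of the latter. -/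
theorem eq_fourier_of_integrable_fourierInv_toLp {F : ℝ → ℂ} (hc : Continuous F) (h₂ : MemLp F 2)
    (hi : Integrable (𝓕⁻ h₂.toLp : Lp ℂ 2 (volume : Measure ℝ))) (t : ℝ) :
    F t = 𝓕 ((𝓕⁻ h₂.toLp : Lp ℂ 2 (volume : Measure ℝ)) : ℝ → ℂ) t := by
  have h := coeFn_fourier_toLp hi (Lp.memLp _)
  rw [Lp.toLp_coeFn, fourier_fourierInv_eq] at h
  exact congrFun (Continuous.ae_eq_iff_eq volume hc (continuous_fourier_of_integrable hi) |>.1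
    (h₂.coeFn_toLp.symm.trans h)) t

/-- Plancherel's theorem for the inverse Fourier integral of a function in `L¹ ∩ L²`, compared
with the inverse `L²`-Fourier transform of another function. -/
theorem eLpNorm_fourierInv_toLp_sub {F h : ℝ → ℂ} (hF : MemLp F 2) (h₁ : Integrable h)
    (h₂ : MemLp h 2) :
    eLpNorm (fun w => (𝓕⁻ hF.toLp : Lp ℂ 2 (volume : Measure ℝ)) w - 𝓕⁻ h w) 2 volume =
      eLpNorm (F - h) 2 volume := by
  have e : (fun w => (𝓕⁻ hF.toLp : Lp ℂ 2 (volume : Measure ℝ)) w - 𝓕⁻ h w) =ᵐ[volume]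
      (𝓕⁻ (hF.sub h₂).toLp : Lp ℂ 2 (volume : Measure ℝ)) := by
    rw [MemLp.toLp_sub hF h₂, sub_eq_add_neg, fourierInv_add,
      fourierInv_neg]
    filter_upwards [coeFn_fourierInv_toLp h₁ h₂, 
      Lp.coeFn_add (𝓕⁻ hF.toLp : Lp ℂ 2 (volume : Measure ℝ)) (-𝓕⁻ h₂.toLp),
      Lp.coeFn_neg (𝓕⁻ h₂.toLp : Lp ℂ 2 (volume : Measure ℝ))] with w hw h' h''
    rw [h', Pi.add_apply, h'', Pi.neg_apply, hw, sub_eq_add_neg]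
  rw [eLpNorm_congr_ae e, ← eLpNorm_congr_ae (hF.sub h₂).coeFn_toLp,
    ← Lp.enorm_def, ← Lp.enorm_def]
  exact congrArg ENNReal.ofNNReal (NNReal.eq
    ((Lp.fourierTransformₗᵢ ℝ ℂ).symm.norm_map (hF.sub h₂).toLp))

end Fourier

/-! ### The triangle wave and its Fourier series -/

theorem triangleWave_of_mem {w : ℝ} (h₁ : -1 ≤ w) (h₂ : w < 1) (m : ℤ) :
    triangleWave (w + 2 * m) = (-1) ^ m * w := by
  unfold triangleWave
  rcases Int.even_or_odd' m with ⟨j, rfl | rfl⟩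
  · have hfl : ⌊(w + 2 * ((2 * j : ℤ) : ℝ) + 3) / 4⌋ = j := by
      rw [Int.floor_eq_iff]; push_cast; constructor <;> linarith
    rw [hfl, Even.neg_one_zpow (by simp)]
    push_cast
    rw [show w + 2 * (2 * (j : ℝ)) + 1 - 4 * j = w + 1 by ring, abs_of_nonneg (by linarith)]
    ring
  · have hfl : ⌊(w + 2 * ((2 * j + 1 : ℤ) : ℝ) + 3) / 4⌋ = j + 1 := by
      rw [Int.floor_eq_iff]; push_cast; constructor <;> linarith
    rw [hfl, Odd.neg_one_zpow (by simp)]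
    push_cast
    rw [show w + 2 * (2 * (j : ℝ) + 1) + 1 - 4 * (j + 1) = w - 1 by ring,
      abs_of_nonpos (by linarith)]
    ring

theorem exists_eq_add_two_mul_int (w : ℝ) : ∃ (w₀ : ℝ) (m : ℤ), -1 ≤ w₀ ∧ w₀ < 1 ∧
    w = w₀ + 2 * m := by
  refine ⟨w - 2 * ⌊(w + 1) / 2⌋, ⌊(w + 1) / 2⌋, ?_, ?_, by ring⟩
  · linarith [Int.floor_le ((w + 1) / 2)]
  · linarith [Int.lt_floor_add_one ((w + 1) / 2)]

theorem abs_triangleWave_le_one (w : ℝ) : |triangleWave w| ≤ 1 := by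
  obtain ⟨w₀, m, h₁, h₂, rfl⟩ := exists_eq_add_two_mul_int w
  rw [triangleWave_of_mem h₁ h₂, abs_mul, abs_zpow, abs_neg, abs_one, one_zpow, one_mul]
  exact abs_le.2 ⟨h₁, h₂.le⟩

theorem triangleWave_of_abs_le_one {w : ℝ} (h : |w| ≤ 1) : triangleWave w = w := by
  rcases (abs_le.1 h).2.lt_or_eq with h' | rfl
  · simpa using triangleWave_of_mem (abs_le.1 h).1 h' 0
  · norm_num [triangleWave]

theorem measurable_triangleWave : Measurable triangleWave := by
  unfold triangleWave
  fun_prop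

open Complex in
-- Shifting `w` by `2m` multiplies each odd harmonic by this factor, matching the sign in
-- `triangleWave_of_mem`.
theorem exp_pi_mul_I_odd (m k : ℤ) :
    cexp (-(Real.pi * I * ((2 * k - 1 : ℤ) * m : ℤ))) = (-1) ^ m := by
  rw [show -(Real.pi * I * (((2 * k - 1 : ℤ) * m : ℤ) : ℂ)) =
    ((-((2 * k - 1 : ℤ) * m) : ℤ) : ℂ) * (Real.pi * I) by push_cast; ring, Complex.exp_int_mul,
    Complex.exp_pi_mul_I, zpow_neg, zpow_mul, Odd.neg_one_zpow ⟨k - 1, by ring⟩]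
  rcases Int.even_or_odd m with h | h <;> simp [h.neg_one_zpow]

open Complex in
/-- The Fourier series of the triangle wave. -/
theorem hasSum_triangleWave (w : ℝ) :
    HasSum (fun k : ℤ => (((-1 : ℝ) ^ (k + 1) / (2 * (k : ℝ) - 1) ^ 2 : ℝ) : ℂ) *
      cexp (-(Real.pi * I * (2 * k - 1) * w / 2))) (-I * (Real.pi ^ 2 / 4) * triangleWave w) := by
  obtain ⟨w₀, m, h₁, h₂, rfl⟩ := exists_eq_add_two_mul_int w
  rw [triangleWave_of_mem h₁ h₂]
  suffices H : HasSum (fun k : ℤ => (((-1 : ℝ) ^ (k + 1) / (2 * (k : ℝ) - 1) ^ 2 : ℝ) : ℂ) *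
      cexp (-(Real.pi * I * (2 * k - 1) * w₀ / 2))) (-I * (Real.pi ^ 2 / 4) * w₀) by
    convert! H.mul_left ((-1 : ℂ) ^ m) using 1
    · ext k
      rw [← exp_pi_mul_I_odd m k, mul_left_comm, ← Complex.exp_add]
      congr 2
      push_cast
      ring
    · push_cast
      ring
  -- The difference `B₂(x) - B₂(x + 1/2) = 1/4 - x` is linear; this `x` makes it `w₀/4`. Both points
  -- lie in `[0, 1]`, where the Bernoulli series is valid.
  set x : ℝ := 1 / 4 - w₀ / 4 with hx
  have S₁ := hasSum_one_div_pow_mul_fourier_mul_bernoulliFun le_rfl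
    (x := x) ⟨by linarith, by linarith⟩
  have S₂ := hasSum_one_div_pow_mul_fourier_mul_bernoulliFun le_rfl
    (x := x + 1 / 2) ⟨by linarith, by linarith⟩
  have hinj : Function.Injective (fun k : ℤ => 2 * k - 1) := fun a b h => by
    simp only at h; omega
  -- In the difference the odd harmonics double and carry the phase `i(-1)^{k+1}`; the factor `-i/2`
  -- removes both the `2` and the `i`.
  have S := ((S₁.sub S₂).mul_left (-I / 2))
  rw [← hinj.hasSum_iff] at S
  · convert! S using 1
    · ext k
      simp only [Function.comp_apply, fourier_coe_apply]
      have e₁ : cexp (2 * Real.pi * I * ((2 * k - 1 : ℤ) : ℂ) * ((x + 1 / 2 : ℝ) : ℂ) / (1 : ℝ)) =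
          -cexp (2 * Real.pi * I * ((2 * k - 1 : ℤ) : ℂ) * (x : ℂ) / (1 : ℝ)) := by
        have h := exp_pi_mul_I_odd (-1) k
        rw [zpow_neg_one, inv_neg_one] at h
        rw [neg_eq_neg_one_mul, ← h, ← Complex.exp_add]
        congr 1
        push_cast
        ring
      have e₂ : cexp (2 * Real.pi * I * ((2 * k - 1 : ℤ) : ℂ) * (x : ℂ) / (1 : ℝ)) =
          I * (-1) ^ (k + 1) * cexp (-(Real.pi * I * (2 * k - 1) * w₀ / 2)) := by
        have : I * (-1) ^ (k + 1) = cexp (((k : ℂ) - 1) * (Real.pi * I)) * I := by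
          rw [show ((k : ℂ) - 1) = ((k - 1 : ℤ) : ℂ) by push_cast; ring, Complex.exp_int_mul,
            Complex.exp_pi_mul_I, mul_comm, show k + 1 = (k - 1) + 2 by ring,
            zpow_add₀ (by norm_num)]
          norm_num
        rw [this, show cexp (((k : ℂ) - 1) * (Real.pi * I)) * I =
          cexp (((k : ℂ) - 1) * (Real.pi * I)) * cexp (Real.pi / 2 * I) by
            rw [Complex.exp_pi_div_two_mul_I], ← Complex.exp_add, ← Complex.exp_add]
        congr 1
        rw [hx]
        push_cast
        ring
      rw [e₁, e₂]
      push_cast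
      linear_combination (1 / (2 * (k : ℂ) - 1) ^ 2 * (-1) ^ (k + 1) *
        cexp (-(Real.pi * I * (2 * k - 1) * w₀ / 2))) * I_sq
    · simp only [bernoulliFun_two]
      rw [hx]
      push_cast
      simp only [Nat.factorial]
      push_cast
      linear_combination (-(1 / 4) * (Real.pi : ℂ) ^ 2 * w₀ * I) * I_sq
  -- Even harmonics have period `1/2` in `x`, so they cancel in the difference.
  · intro n hn
    have hev : Even n := by
      by_contra h
      obtain ⟨j, rfl⟩ := Int.not_even_iff_odd.1 h
      exact hn ⟨j + 1, by ring⟩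
    obtain ⟨j, rfl⟩ := hev
    have : cexp (2 * Real.pi * I * ((j + j : ℤ) : ℂ) * ((x + 1 / 2 : ℝ) : ℂ) / (1 : ℝ)) =
          cexp (2 * Real.pi * I * ((j + j : ℤ) : ℂ) * (x : ℂ) / (1 : ℝ)) := by
      rw [Complex.exp_eq_exp_iff_exists_int]
      refine ⟨j, ?_⟩
      push_cast
      ring
    simp only [fourier_coe_apply, this]
    ring

/-! ### Mellin transform, inversion and uniqueness -/

/-- The function `t ↦ e ^ (ct) f(e ^ t)`, which carries Mellin analysis on `ℝ⁺` to Fourier analysis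
on `ℝ`. -/
noncomputable def logLift (c : ℝ) (f : ℝ → ℂ) (t : ℝ) : ℂ :=
  (Real.exp (c * t) : ℂ) * f (Real.exp t)

theorem continuous_logLift (c : ℝ) {f : ℝ → ℂ} (hf : ContinuousOn f (Set.Ioi 0)) :
    Continuous (logLift c f) := by
  have : Continuous fun t => f (Real.exp t) :=
    hf.comp_continuous Real.continuous_exp fun t => Real.exp_pos t
  exact (Complex.continuous_ofReal.comp (Real.continuous_exp.comp (continuous_const_mul c))).mul
    this

theorem eq_rpow_mul_logLift (c : ℝ) (f : ℝ → ℂ) {x : ℝ} (hx : 0 < x) :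
    f x = ((x ^ (-c) : ℝ) : ℂ) * logLift c f (Real.log x) := by
  rw [logLift, Real.exp_log hx, ← mul_assoc, ← Complex.ofReal_mul, mul_comm c,
    ← Real.rpow_def_of_pos hx, ← Real.rpow_add hx]
  simp

theorem cpow_neg_sub_I_mul (c v : ℝ) {x : ℝ} (hx : 0 < x) :
    (x : ℂ) ^ (-(c : ℂ) - Complex.I * (v : ℂ)) =
      ((x ^ (-c) : ℝ) : ℂ) * Complex.exp (-(Complex.I * v * Real.log x)) := by
  have hx' : (x : ℂ) ≠ 0 := by exact_mod_cast hx.ne'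
  rw [Complex.cpow_sub _ _ hx', ← Complex.ofReal_neg, ← Complex.ofReal_cpow hx.le,
    Complex.cpow_def_of_ne_zero hx', ← Complex.ofReal_log hx.le, Complex.exp_neg, div_eq_mul_inv]
  congr 3
  ring

theorem norm_cpow_neg_sub_I_mul (c v : ℝ) {x : ℝ} (hx : 0 < x) :
    ‖(x : ℂ) ^ (-(c : ℂ) - Complex.I * (v : ℂ))‖ = x ^ (-c) := by
  rw [Complex.norm_cpow_eq_rpow_re_of_pos hx]
  simp

/-- Substitute `u = e^t`: after squaring, the exponent `-1/2` in the weight cancels the Jacobian. -/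
theorem memLp_logLift {c : ℝ} {f : ℝ → ℂ} (hX : MemX2 c f) (hf : ContinuousOn f (Set.Ioi 0)) :
    MemLp (logLift c f) 2 := by
  refine ⟨(continuous_logLift c hf).aestronglyMeasurable, ?_⟩
  have h := hX.2
  rw [eLpNorm_lt_top_iff_lintegral_rpow_enorm_lt_top (by norm_num) (by norm_num)] at h ⊢
  rw [← Real.range_exp, ← Set.image_univ, lintegral_image_eq_lintegral_abs_deriv_mul
    MeasurableSet.univ (fun x _ => (Real.hasDerivAt_exp x).hasDerivWithinAt)
    (Real.exp_injective.injOn), setLIntegral_univ] at h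
  convert! h using 3 with t
  simp only [ENNReal.toReal_ofNat, logLift, enorm_mul]
  rw [ENNReal.mul_rpow_of_nonneg _ _ (by norm_num), ENNReal.mul_rpow_of_nonneg _ _ (by norm_num),
    ← mul_assoc]
  congr 1
  simp only [← ofReal_norm, Complex.norm_real, Real.norm_eq_abs]
  rw [ENNReal.ofReal_rpow_of_nonneg (abs_nonneg _) (by norm_num),
    ENNReal.ofReal_rpow_of_nonneg (abs_nonneg _) (by norm_num),
    ← ENNReal.ofReal_mul (abs_nonneg _)]
  congr 1
  rw [abs_of_pos (Real.exp_pos _), abs_of_pos (Real.exp_pos _),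
    abs_of_pos (Real.rpow_pos_of_pos (Real.exp_pos _) _), ← Real.exp_mul, ← Real.exp_mul,
    ← Real.exp_mul, ← Real.exp_add]
  congr 1
  ring

section Mellin

open FourierTransform

/-- The substitution `u = e^t` again; the argument `v/(2π)` compensates for the kernel `e^{2πitw}`
of `𝓕⁻`. -/
theorem truncatedMellin_eq_fourierInv (c : ℝ) {f : ℝ → ℂ} (hf : ContinuousOn f (Set.Ioi 0))
    {ρ : ℝ} (hρ : 1 ≤ ρ) (v : ℝ) :
    truncatedMellin c f ρ v =
      𝓕⁻ ((Set.Ioc (-Real.log ρ) (Real.log ρ)).indicator (logLift c f)) (v / (2 * Real.pi)) := by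
  have hρ0 : 0 < ρ := by linarith
  have hl : 0 ≤ Real.log ρ := Real.log_nonneg hρ
  have hcv := intervalIntegral.integral_deriv_smul_comp' (a := -Real.log ρ) (b := Real.log ρ)
    (f := Real.exp) (f' := Real.exp)
    (g := fun u : ℝ => f u * (u : ℂ) ^ ((c : ℂ) + Complex.I * (v : ℂ) - 1))
    (fun x _ => Real.hasDerivAt_exp x) Real.continuous_exp.continuousOn (by
      have hsub : Real.exp '' Set.uIcc (-Real.log ρ) (Real.log ρ) ⊆ Set.Ioi 0 := by
        rintro _ ⟨t, _, rfl⟩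
        exact Real.exp_pos t
      refine (hf.mono hsub).mul fun u hu => ?_
      exact (Complex.continuousAt_ofReal_cpow_const _ _
        (Or.inr (hsub hu).ne')).continuousWithinAt)
  rw [Real.exp_neg, Real.exp_log hρ0, ← one_div] at hcv
  rw [truncatedMellin, ← hcv, intervalIntegral.integral_of_le (by linarith),
    ← integral_indicator measurableSet_Ioc, Real.fourierInv_eq']
  congr 1 with t
  by_cases ht : t ∈ Set.Ioc (-Real.log ρ) (Real.log ρ)
  · simp only [Set.indicator_of_mem ht, Function.comp_apply, logLift, Complex.real_smul,
      smul_eq_mul]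
    have hx' : (Real.exp t : ℂ) ≠ 0 := by exact_mod_cast (Real.exp_pos t).ne'
    rw [Complex.cpow_def_of_ne_zero hx', ← Complex.ofReal_log (Real.exp_pos t).le, Real.log_exp,
      mul_left_comm, Complex.ofReal_exp, ← Complex.exp_add, mul_left_comm _ _ (f _),
      mul_comm _ (f _), ← mul_assoc, mul_comm _ (f _), mul_assoc, Complex.ofReal_exp (c * t),
      ← Complex.exp_add]
    congr 2
    have hpi : (Real.pi : ℂ) ≠ 0 := by exact_mod_cast Real.pi_ne_zero
    simp
    field_simp
    ring
  · simp [Set.indicator_of_notMem ht]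

theorem eLpNorm_comp_div {a : ℝ} (ha : 0 < a) (h : ℝ → ℂ) :
    eLpNorm (fun v => h (v / a)) 2 volume =
      ENNReal.ofReal a ^ (1 / 2 : ℝ) * eLpNorm h 2 volume := by
  have ha' : a⁻¹ ≠ 0 := (inv_pos.2 ha).ne'
  have e := (Homeomorph.mulRight₀ a⁻¹ ha').measurableEmbedding.eLpNorm_map_measure
    (μ := volume) (p := 2) (g := h)
  have e2 : Measure.map (Homeomorph.mulRight₀ a⁻¹ ha') volume =
      ENNReal.ofReal a • (volume : Measure ℝ) := by
    have := Real.map_volume_mul_right ha'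
    rw [inv_inv, abs_of_pos ha] at this
    exact this
  rw [e2, eLpNorm_smul_measure_of_ne_zero (by simpa using ha)] at e
  simpa [Function.comp_def, div_eq_mul_inv] using e.symm

theorem tendsto_eLpNorm_sub_indicator_Ioc {F : ℝ → ℂ} (hF : MemLp F 2) :
    Tendsto (fun r : ℝ => eLpNorm (F - (Set.Ioc (-r) r).indicator F) 2 volume) atTop (𝓝 0) := by
  have key : Tendsto (fun r : ℝ => ∫⁻ t, ‖(F - (Set.Ioc (-r) r).indicator F) t‖ₑ ^ (2 : ℝ))
      atTop (𝓝 (∫⁻ _ : ℝ, 0)) := by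
    refine tendsto_lintegral_filter_of_dominated_convergence' (fun t => ‖F t‖ₑ ^ (2 : ℝ))
      ?_ ?_ ?_ ?_
    · exact Eventually.of_forall fun r =>
        (hF.1.sub (hF.1.indicator measurableSet_Ioc)).enorm.pow_const _
    · refine Eventually.of_forall fun r => Eventually.of_forall fun t => ?_
      refine ENNReal.rpow_le_rpow ?_ (by norm_num)
      by_cases ht : t ∈ Set.Ioc (-r) r <;> simp [ht]
    · have h := hF.2
      rw [eLpNorm_lt_top_iff_lintegral_rpow_enorm_lt_top (by norm_num) (by norm_num)] at h
      simpa using h.ne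
    · refine Eventually.of_forall fun t => tendsto_const_nhds.congr' ?_
      filter_upwards [eventually_gt_atTop |t|] with r hr
      have ht : t ∈ Set.Ioc (-r) r := ⟨(abs_lt.1 hr).1, (abs_lt.1 hr).2.le⟩
      simp [ht]
  have h := key.ennrpow_const (1 / 2 : ℝ)
  rw [lintegral_zero, ENNReal.zero_rpow_of_pos (by norm_num)] at h
  refine h.congr fun r => ?_
  rw [eLpNorm_eq_lintegral_rpow_enorm_toReal (by norm_num) (by norm_num)]
  simp

theorem integrable_indicator_Ioc_logLift (c r : ℝ) {f : ℝ → ℂ}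
    (hf : ContinuousOn f (Set.Ioi 0)) :
    Integrable ((Set.Ioc (-r) r).indicator (logLift c f)) :=
  ((continuous_logLift c hf).integrableOn_Icc.mono_set
    Set.Ioc_subset_Icc_self).integrable_indicator measurableSet_Ioc

/-- Truncations of `logLift c f` converge in `L²`, and Plancherel carries this over to their
transforms. This existence is what gives the choice in `mellinTransform` a meaning. -/
theorem isMellinTransform_fourierInv {c : ℝ} {f : ℝ → ℂ} (hf : ContinuousOn f (Set.Ioi 0))
    (h₂ : MemLp (logLift c f) 2) :
    IsMellinTransform c f
      (fun v => (𝓕⁻ h₂.toLp : Lp ℂ 2 (volume : Measure ℝ)) (v / (2 * Real.pi))) := by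
  have hpi : 0 < 2 * Real.pi := Real.two_pi_pos
  set g : Lp ℂ 2 (volume : Measure ℝ) := 𝓕⁻ h₂.toLp with hg
  refine ⟨⟨?_, ?_⟩, ?_⟩
  · refine (Lp.aestronglyMeasurable g).comp_quasiMeasurePreserving ⟨by fun_prop, ?_⟩
    simp only [div_eq_mul_inv]
    rw [Real.map_volume_mul_right (inv_ne_zero hpi.ne')]
    exact Measure.smul_absolutelyContinuous
  · rw [eLpNorm_comp_div hpi]
    exact ENNReal.mul_lt_top (ENNReal.rpow_lt_top_of_nonneg (by norm_num) ENNReal.ofReal_ne_top)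
      (Lp.memLp g).2
  · have h := ENNReal.Tendsto.const_mul (a := ENNReal.ofReal (2 * Real.pi) ^ (1 / 2 : ℝ))
      ((tendsto_eLpNorm_sub_indicator_Ioc h₂).comp Real.tendsto_log_atTop)
      (Or.inr (ENNReal.rpow_ne_top_of_nonneg (by norm_num) ENNReal.ofReal_ne_top))
    rw [mul_zero] at h
    refine h.congr' ?_
    filter_upwards [eventually_ge_atTop 1] with ρ hρ
    simp only [truncatedMellin_eq_fourierInv c hf hρ, Function.comp_apply]
    rw [eLpNorm_comp_div hpi (fun w => g w -
      𝓕⁻ ((Set.Ioc (-Real.log ρ) (Real.log ρ)).indicator (logLift c f)) w), hg,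
      eLpNorm_fourierInv_toLp_sub h₂ (integrable_indicator_Ioc_logLift c _ hf)
      (h₂.indicator measurableSet_Ioc)]

theorem aestronglyMeasurable_truncatedMellin (c : ℝ) {f : ℝ → ℂ}
    (hf : ContinuousOn f (Set.Ioi 0)) {ρ : ℝ} (hρ : 1 ≤ ρ) :
    AEStronglyMeasurable (truncatedMellin c f ρ) volume := by
  refine Continuous.aestronglyMeasurable ?_
  rw [funext (truncatedMellin_eq_fourierInv c hf hρ)]
  exact (continuous_fourierInv_of_integrable (integrable_indicator_Ioc_logLift c _ hf)).comp
    (continuous_id.div_const _)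

theorem MellinBoas.IsMellinTransform.ae_eq {c : ℝ} {f g g' : ℝ → ℂ}
    (hf : ContinuousOn f (Set.Ioi 0))
    (hg : IsMellinTransform c f g) (hg' : IsMellinTransform c f g') : g =ᵐ[volume] g' := by
  have hz : eLpNorm (g - g') 2 volume ≤ 0 := by
    have hsum := hg.2.add hg'.2
    rw [add_zero] at hsum
    refine ge_of_tendsto hsum ?_
    filter_upwards [eventually_ge_atTop 1] with ρ hρ
    have hm := aestronglyMeasurable_truncatedMellin c hf hρ
    convert! eLpNorm_sub_le (p := 2) (hg.1.1.sub hm) (hg'.1.1.sub hm) (by norm_num) using 2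
    ext t
    simp
  rw [nonpos_iff_eq_zero, eLpNorm_eq_zero_iff (hg.1.1.sub hg'.1.1) (by norm_num)] at hz
  filter_upwards [hz] with t ht
  exact sub_eq_zero.1 ht

theorem isMellinTransform_mellinTransform {c : ℝ} {f : ℝ → ℂ} (hX : MemX2 c f)
    (hf : ContinuousOn f (Set.Ioi 0)) : IsMellinTransform c f (mellinTransform c f) :=
  Classical.epsilon_spec ⟨_, isMellinTransform_fourierInv hf (memLp_logLift hX hf)⟩

theorem mellinTransform_ae_eq_fourierInv {c : ℝ} {f : ℝ → ℂ} (hX : MemX2 c f)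
    (hf : ContinuousOn f (Set.Ioi 0)) : mellinTransform c f =ᵐ[volume] fun v =>
      (𝓕⁻ (memLp_logLift hX hf).toLp : Lp ℂ 2 (volume : Measure ℝ)) (v / (2 * Real.pi)) :=
  (isMellinTransform_mellinTransform hX hf).ae_eq hf (isMellinTransform_fourierInv hf _)

theorem fourier_eq_integral_exp (h : ℝ → ℂ) (t : ℝ) :
    𝓕 h t = 1 / (2 * (Real.pi : ℂ)) *
      ∫ v : ℝ, h (v / (2 * Real.pi)) * Complex.exp (-(Complex.I * v * t)) := by
  have hpi : (Real.pi : ℂ) ≠ 0 := by exact_mod_cast Real.pi_ne_zero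
  have e : ∀ v : ℝ, h (v / (2 * Real.pi)) * Complex.exp (-(Complex.I * v * t)) =
      (fun w : ℝ => Complex.exp ((-2 * Real.pi * w * t : ℝ) * Complex.I) • h w)
        (v / (2 * Real.pi)) := by
    intro v
    simp only [smul_eq_mul]
    rw [mul_comm]
    congr 2
    push_cast
    field_simp
  simp only [e]
  rw [Measure.integral_comp_div
    (fun w : ℝ => Complex.exp ((-2 * Real.pi * w * t : ℝ) * Complex.I) • h w),
    abs_of_pos Real.two_pi_pos,
    Real.fourier_real_eq_integral_exp_smul,
    Complex.real_smul, ← mul_assoc,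
    show 1 / (2 * (Real.pi : ℂ)) * ((2 * Real.pi : ℝ) : ℂ) = 1 by push_cast; field_simp, one_mul]

theorem integral_mul_cpow {c x : ℝ} (hx : 0 < x) (φ : ℝ → ℂ) :
    ∫ v : ℝ, φ v * (x : ℂ) ^ (-(c : ℂ) - Complex.I * (v : ℂ)) =
      ((x ^ (-c) : ℝ) : ℂ) * ∫ v : ℝ, φ v * Complex.exp (-(Complex.I * v * Real.log x)) := by
  rw [← integral_const_mul]
  congr 1 with v
  rw [cpow_neg_sub_I_mul c v hx]
  ring

/-- Mellin inversion. -/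
theorem represents_mellinTransform {c : ℝ} {f : ℝ → ℂ} (hX : MemX2 c f)
    (hf : ContinuousOn f (Set.Ioi 0)) (hi : Integrable (mellinTransform c f)) :
    Represents 1 c f (mellinTransform c f) := by
  refine ⟨hi, memLp_one_iff_integrable.2 hi, fun x hx => ?_⟩
  have hae := mellinTransform_ae_eq_fourierInv hX hf
  have hi' := hi.congr hae
  rw [integrable_comp_div_iff _ Real.two_pi_pos.ne'] at hi'
  rw [eq_rpow_mul_logLift c f hx, integral_mul_cpow hx,
    eq_fourier_of_integrable_fourierInv_toLp (continuous_logLift c hf) (memLp_logLift hX hf) hi',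
    fourier_eq_integral_exp, mul_left_comm]
  congr 2
  refine integral_congr_ae ?_
  filter_upwards [hae] with v hv
  rw [hv]

/-- Rescaled by `2π`, a representing function has Fourier transform `logLift c f`, so injectivity of
`𝓕` on `L¹` applies. -/
theorem MellinBoas.Represents.ae_eq {q : ℝ≥0∞} {c : ℝ} {f φ φ' : ℝ → ℂ} (h : Represents q c f φ)
    (h' : Represents q c f φ') : φ =ᵐ[volume] φ' := by
  have hpi : (2 * Real.pi) ≠ 0 := Real.two_pi_pos.ne'
  have hs : ∀ φ : ℝ → ℂ, Represents q c f φ → ∀ t : ℝ,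
      𝓕 (fun w => φ (w * (2 * Real.pi))) t = logLift c f t := by
    intro φ h t
    rw [fourier_eq_integral_exp]
    simp only [div_mul_cancel₀ _ hpi]
    have e := h.2.2 (Real.exp t) (Real.exp_pos t)
    rw [integral_mul_cpow (Real.exp_pos t), Real.log_exp] at e
    rw [logLift, e, mul_left_comm, ← mul_assoc (Real.exp (c * t) : ℂ), ← Complex.ofReal_mul,
      ← Real.exp_mul, ← Real.exp_add]
    simp [mul_comm]
  have hae := ae_eq_of_fourier_eq (h.1.comp_mul_right' hpi) (h'.1.comp_mul_right' hpi)
    fun t => (hs φ h t).trans (hs φ' h' t).symm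
  have hq : Measure.QuasiMeasurePreserving (fun v : ℝ => v / (2 * Real.pi)) := by
    refine ⟨by fun_prop, ?_⟩
    simp only [div_eq_mul_inv]
    rw [Real.map_volume_mul_right (inv_ne_zero hpi)]
    exact Measure.smul_absolutelyContinuous
  filter_upwards [hq.ae hae] with v hv
  simpa only [div_mul_cancel₀ _ hpi] using hv

end Mellin

/-! ### Mellin derivative and Boas series as multipliers -/

theorem norm_exp_neg_I_mul_mul (v t : ℝ) : ‖Complex.exp (-(Complex.I * v * t))‖ = 1 := by
  rw [show -(Complex.I * v * t) = ((-(v * t) : ℝ) : ℂ) * Complex.I by push_cast; ring]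
  exact Complex.norm_exp_ofReal_mul_I _

theorem hasDerivAt_integral_mul_exp {φ : ℝ → ℂ} (hφ : Integrable φ)
    (hv : Integrable fun v : ℝ => (v : ℂ) * φ v) (t : ℝ) :
    HasDerivAt (fun t : ℝ => ∫ v : ℝ, φ v * Complex.exp (-(Complex.I * v * t)))
      (∫ v : ℝ, (-Complex.I * (v * φ v)) * Complex.exp (-(Complex.I * v * t))) t := by
  have hexp : ∀ t : ℝ, AEStronglyMeasurable (fun v : ℝ => Complex.exp (-(Complex.I * v * t))) :=
    fun t => Continuous.aestronglyMeasurable (by fun_prop)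
  refine (hasDerivAt_integral_of_dominated_loc_of_deriv_le (𝕜 := ℝ)
    (bound := fun v : ℝ => ‖(v : ℂ) * φ v‖)
    (F' := fun t v => (-Complex.I * (v * φ v)) * Complex.exp (-(Complex.I * v * t)))
    (s := Set.univ) univ_mem ?_ ?_ ?_ ?_ hv.norm ?_).2
  · exact Eventually.of_forall fun t => hφ.1.mul (hexp t)
  · exact hφ.mul_bdd (c := 1) (hexp t)
      (Eventually.of_forall fun v => (norm_exp_neg_I_mul_mul v t).le)
  · exact (hv.1.const_mul _).mul (hexp t)
  · refine Eventually.of_forall fun v s _ => ?_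
    rw [norm_mul, norm_exp_neg_I_mul_mul, norm_mul, norm_neg, Complex.norm_I, one_mul, mul_one]
  · refine Eventually.of_forall fun v s _ => ?_
    have h : HasDerivAt (fun s : ℝ => -(Complex.I * v * s)) (-(Complex.I * v)) s := by
      simpa using ((hasDerivAt_id s).ofReal_comp.const_mul (Complex.I * v)).fun_neg
    convert! (h.cexp).const_mul (φ v) using 1
    ring

/-- A function represented by `φ` has a Mellin derivative, represented by `-iv φ(v)`. -/
theorem hasMellinDeriv_of_represents {c : ℝ} {f φ : ℝ → ℂ} (h : Represents 1 c f φ)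
    (hv : Integrable fun v : ℝ => (v : ℂ) * φ v) {x : ℝ} (hx : 0 < x) :
    HasMellinDeriv c f x (1 / (2 * (Real.pi : ℂ)) * ∫ v : ℝ, (-Complex.I * (v * φ v)) *
      (x : ℂ) ^ (-(c : ℂ) - Complex.I * (v : ℂ))) := by
  set G : ℝ → ℂ := fun t => ∫ v : ℝ, φ v * Complex.exp (-(Complex.I * v * t)) with hG
  have hf : ∀ y : ℝ, 0 < y → f y = 1 / (2 * (Real.pi : ℂ)) * (((y ^ (-c) : ℝ) : ℂ) *
      G (Real.log y)) := by
    intro y hy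
    rw [h.2.2 y hy, integral_mul_cpow hy]
  -- Since `h^c` cancels `h^{-c}`, the Mellin quotient is the ordinary slope at `h = 1` of a
  -- constant times `G(log h + log x)`.
  have hlog : HasDerivAt (fun y : ℝ => Real.log y + Real.log x) 1 1 := by
    simpa using (Real.hasDerivAt_log one_ne_zero).add_const (Real.log x)
  have hd := (HasDerivAt.scomp_of_eq (1 : ℝ)
    (hasDerivAt_integral_mul_exp h.1 hv (Real.log x)) hlog (by simp)).const_mul
    (1 / (2 * (Real.pi : ℂ)) * ((x ^ (-c) : ℝ) : ℂ))
  rw [one_smul, hasDerivAt_iff_tendsto_slope] at hd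
  rw [integral_mul_cpow hx, ← mul_assoc]
  refine hd.congr' ?_
  filter_upwards [nhdsWithin_le_nhds (lt_mem_nhds (zero_lt_one' ℝ))] with y hy
  rw [slope_def_module, mellinQuotient, hf x hx, hf (y * x) (mul_pos hy hx), Complex.real_smul,
    Real.log_mul hy.ne' hx.ne', Real.mul_rpow hy.le hx.le]
  have e : ((y ^ c : ℝ) : ℂ) * ((y ^ (-c) : ℝ) : ℂ) = 1 := by
    rw [← Complex.ofReal_mul, ← Real.rpow_add hy]
    simp
  simp only [Function.comp_apply, Real.log_one, zero_add, ← hG]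
  push_cast
  rw [div_eq_inv_mul]
  linear_combination (-((y : ℂ) - 1)⁻¹ * (1 / (2 * (Real.pi : ℂ))) * ((x ^ (-c) : ℝ) : ℂ) *
    G (Real.log y + Real.log x)) * e

theorem aestronglyMeasurable_cpow (c : ℝ) {x : ℝ} (hx : 0 < x) :
    AEStronglyMeasurable (fun v : ℝ => (x : ℂ) ^ (-(c : ℂ) - Complex.I * (v : ℂ))) volume := by
  refine Continuous.aestronglyMeasurable ?_
  simp only [cpow_neg_sub_I_mul c _ hx]
  fun_prop

theorem integrable_mul_cpow {c x : ℝ} (hx : 0 < x) {φ : ℝ → ℂ} (hφ : Integrable φ) :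
    Integrable fun v : ℝ => φ v * (x : ℂ) ^ (-(c : ℂ) - Complex.I * (v : ℂ)) :=
  hφ.mul_bdd (c := x ^ (-c)) (aestronglyMeasurable_cpow c hx)
    (Eventually.of_forall fun v => (norm_cpow_neg_sub_I_mul c v hx).le)

/-- At `w = 0` all exponentials of the series are `1`. -/
theorem summable_boas_coefficient :
    Summable fun k : ℤ => ‖(((-1 : ℝ) ^ (k + 1) / (2 * (k : ℝ) - 1) ^ 2 : ℝ) : ℂ)‖ := by
  have h := (hasSum_triangleWave 0).summable.norm
  simpa using h

/-- The Boas series of a function represented by `φ`. -/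
theorem hasSum_boasTerm {c T : ℝ} (hT : 0 < T) {f φ : ℝ → ℂ} (h : Represents 1 c f φ)
    {x : ℝ} (hx : 0 < x) :
    HasSum (boasTerm c T f x) (1 / (2 * (Real.pi : ℂ)) * ∫ v : ℝ,
      -Complex.I * (Real.pi ^ 2 / 4) * triangleWave (v / (Real.pi * T)) *
        (φ v * (x : ℂ) ^ (-(c : ℂ) - Complex.I * (v : ℂ)))) := by
  have hpi := Real.pi_ne_zero
  set a : ℤ → ℂ := fun k => (((-1 : ℝ) ^ (k + 1) / (2 * (k : ℝ) - 1) ^ 2 : ℝ) : ℂ) with ha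
  set E : ℤ → ℝ → ℂ := fun k v =>
    Complex.exp (-(Real.pi * Complex.I * (2 * k - 1) * (v / (Real.pi * T) : ℝ) / 2)) with hE
  set ψ : ℝ → ℂ := fun v => φ v * (x : ℂ) ^ (-(c : ℂ) - Complex.I * (v : ℂ)) with hψ
  -- The `k`-th harmonic at `v/(πT)` is the factor that `x^{-iv}` acquires when `x` is dilated by
  -- `e^{(k-1/2)/T}`.
  have hE1 : ∀ k v, E k v = Complex.exp (-(Complex.I * v * (((k : ℝ) - 1 / 2) / T : ℝ))) := by
    intro k v
    simp only [hE]
    congr 1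
    have : (Real.pi : ℂ) ≠ 0 := by exact_mod_cast hpi
    have : (T : ℂ) ≠ 0 := by exact_mod_cast hT.ne'
    push_cast
    field_simp
  have hEn : ∀ k v, ‖E k v‖ = 1 := fun k v => by rw [hE1, norm_exp_neg_I_mul_mul]
  have hψi : Integrable ψ := integrable_mul_cpow hx h.1
  have hi : ∀ k, Integrable fun v => a k * E k v * ψ v := by
    intro k
    have hm : AEStronglyMeasurable (E k) volume := Continuous.aestronglyMeasurable (by
      rw [funext (hE1 k)]; fun_prop)
    simp only [mul_assoc]
    exact (hψi.bdd_mul (c := 1) hm (Eventually.of_forall fun v => (hEn k v).le)).const_mul _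
  have hS : Summable fun k => ∫ v, ‖a k * E k v * ψ v‖ := by
    simp only [norm_mul, hEn, mul_one, integral_const_mul]
    exact summable_boas_coefficient.mul_right _
  have key := (hasSum_integral_of_summable_integral_norm hi hS).mul_left (1 / (2 * (Real.pi : ℂ)))
  convert! key using 1
  · ext k
    have hp : 0 < x * Real.exp (((k : ℝ) - 1 / 2) / T) := mul_pos hx (Real.exp_pos _)
    rw [boasTerm, h.2.2 _ hp, mul_left_comm, ← integral_const_mul]
    congr 2 with v
    rw [hE1, cpow_neg_sub_I_mul c v hp]
    simp only [hψ, ha]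
    rw [cpow_neg_sub_I_mul c v hx, Real.log_mul hx.ne' (Real.exp_pos _).ne', Real.log_exp,
      Real.mul_rpow hx.le (Real.exp_pos _).le, ← Real.exp_mul]
    -- The exponential weight in the Boas term undoes the effect of the dilation on `x^{-c}`.
    have e : ((Real.exp (((k : ℝ) - 1 / 2) * c / T) : ℝ) : ℂ) *
        ((Real.exp (((k : ℝ) - 1 / 2) / T * -c) : ℝ) : ℂ) = 1 := by
      rw [← Complex.ofReal_mul, ← Real.exp_add, show ((k : ℝ) - 1 / 2) * c / T +
        ((k : ℝ) - 1 / 2) / T * -c = 0 by ring]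
      simp
    rw [Complex.ofReal_add, mul_add, neg_add, Complex.exp_add, Complex.ofReal_mul,
      Complex.ofReal_mul]
    linear_combination (((((-1 : ℝ) ^ (k + 1) / (2 * (k : ℝ) - 1) ^ 2 : ℝ) : ℂ)) * φ v *
      ((x ^ (-c) : ℝ) : ℂ) * Complex.exp (-(Complex.I * v * Real.log x)) *
      Complex.exp (-(Complex.I * v * (((k : ℝ) - 1 / 2) / T : ℝ)))) * e
  · congr 2 with v
    exact ((hasSum_triangleWave (v / (Real.pi * T))).mul_right (ψ v)).tsum_eq.symm

/-! ### Bernstein spaces and the distance -/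

/-- The competitor that makes the distance finite. As the transform is a chosen representative, its
vanishing rests on uniqueness. -/
theorem memB2_zero (c σ : ℝ) : MemB2 c σ 0 := by
  have hX : MemX2 c 0 := by simp [MemX2]
  have hc : ContinuousOn (0 : ℝ → ℂ) (Set.Ioi 0) := continuousOn_const
  refine ⟨hX, hc, ?_⟩
  have h0 : IsMellinTransform c 0 0 := by
    refine ⟨MemLp.zero, ?_⟩
    simp [truncatedMellin]
  filter_upwards [(isMellinTransform_mellinTransform hX hc).ae_eq hc h0] with v hv _
  exact hv

/-- On a bounded interval `L²` is contained in `L¹`; hence Mellin inversion applies to `g`. -/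
theorem integrable_mellinTransform_of_memB2 {c σ : ℝ} {g : ℝ → ℂ} (hg : MemB2 c σ g) :
    Integrable (mellinTransform c g) := by
  have h₂ := (isMellinTransform_mellinTransform hg.1 hg.2.1).1
  have hon : IntegrableOn (mellinTransform c g) (Set.Icc (-σ) σ) :=
    (h₂.restrict _).integrable (by norm_num)
  refine (hon.integrable_indicator measurableSet_Icc).congr ?_
  filter_upwards [hg.2.2] with v hv
  by_cases h : v ∈ Set.Icc (-σ) σ
  · simp [h]
  · rw [Set.indicator_of_notMem h, hv (not_le.1 fun h' => h (abs_le.1 h'))]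

theorem MellinBoas.Represents.add {c : ℝ} {f g φ ψ : ℝ → ℂ} (h : Represents 1 c f φ)
    (h' : Represents 1 c g ψ) : Represents 1 c (f + g) (φ + ψ) := by
  refine ⟨h.1.add h'.1, h.2.1.add h'.2.1, fun x hx => ?_⟩
  simp only [Pi.add_apply, add_mul]
  rw [integral_add (integrable_mul_cpow hx h.1) (integrable_mul_cpow hx h'.1), h.2.2 x hx,
    h'.2.2 x hx]
  ring

/-- Functions in `B²_{c,σ}` do not influence the part of the representing function outside
`[-σ, σ]`. -/
theorem setLIntegral_enorm_le_distB2 {c σ : ℝ} {f φ : ℝ → ℂ} (h : Represents 1 c f φ) :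
    ∫⁻ v in {v : ℝ | σ < |v|}, ‖φ v‖ₑ ≤ distB2 1 c σ f := by
  refine le_iInf₂ fun g hg => le_iInf₂ fun ψ hψ => ?_
  -- Adding the transform of `g` to `ψ` represents `f`, so by uniqueness the sum is `φ`; outside the
  -- band it is `ψ` alone.
  have hr := hψ.add (represents_mellinTransform hg.1 hg.2.1
    (integrable_mellinTransform_of_memB2 hg))
  rw [sub_add_cancel] at hr
  have hm : MeasurableSet {v : ℝ | σ < |v|} :=
    measurableSet_lt measurable_const measurable_norm
  rw [eLpNorm_one_eq_lintegral_enorm]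
  refine le_trans (le_of_eq ?_) (setLIntegral_le_lintegral {v : ℝ | σ < |v|} _)
  refine setLIntegral_congr_fun_ae hm ?_
  filter_upwards [h.ae_eq hr, hg.2.2] with v hv hz hσ
  rw [hv, Pi.add_apply, hz hσ, add_zero]

/-! ### The remainder and its bounds -/

section Remainder

variable {c T : ℝ} {f : ℝ → ℂ}

theorem integrable_triangleWave_mul (T : ℝ) {ψ : ℝ → ℂ} (hψ : Integrable ψ) :
    Integrable fun v : ℝ => (triangleWave (v / (Real.pi * T)) : ℂ) * ψ v := by
  refine hψ.bdd_mul (c := 1) ?_ (Eventually.of_forall fun v => ?_)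
  · exact (Complex.measurable_ofReal.comp
      (measurable_triangleWave.comp (measurable_id.div_const _))).aestronglyMeasurable
  · rw [Complex.norm_real]
    exact abs_triangleWave_le_one _

theorem remainderIntegrand_eq (c T : ℝ) (f : ℝ → ℂ) (x v : ℝ) :
    remainderIntegrand c T f x v =
      ((v : ℂ) * mellinTransform c f v) * (x : ℂ) ^ (-(c : ℂ) - Complex.I * (v : ℂ)) -
      Real.pi * T * ((triangleWave (v / (Real.pi * T)) : ℂ) *
        (mellinTransform c f v * (x : ℂ) ^ (-(c : ℂ) - Complex.I * (v : ℂ)))) := by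
  rw [remainderIntegrand]
  push_cast
  ring

theorem integrable_remainderIntegrand (hi : Integrable (mellinTransform c f))
    (hv : Integrable fun v : ℝ => (v : ℂ) * mellinTransform c f v) (T : ℝ) {x : ℝ} (hx : 0 < x) :
    Integrable (remainderIntegrand c T f x) := by
  rw [funext (remainderIntegrand_eq c T f x)]
  exact (integrable_mul_cpow hx hv).sub
    ((integrable_triangleWave_mul T (integrable_mul_cpow hx hi)).const_mul _)

theorem remainderIntegrand_eq_zero (hT : 0 < T) (x : ℝ) {v : ℝ} (h : |v| ≤ Real.pi * T) :
    remainderIntegrand c T f x v = 0 := by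
  have hp : 0 < Real.pi * T := mul_pos Real.pi_pos hT
  rw [remainderIntegrand, triangleWave_of_abs_le_one, mul_div_cancel₀ _ hp.ne']
  · simp
  · rw [abs_div, abs_of_pos hp]
    exact (div_le_one hp).2 h

theorem norm_remainderIntegrand_le (hT : 0 < T) {x : ℝ} (hx : 0 < x) (v : ℝ) :
    ‖remainderIntegrand c T f x v‖ ≤
      x ^ (-c) * ((|v| + Real.pi * T) * ‖mellinTransform c f v‖) := by
  have hp : 0 < Real.pi * T := mul_pos Real.pi_pos hT
  rw [remainderIntegrand, norm_mul, norm_mul, norm_cpow_neg_sub_I_mul c v hx, Complex.norm_real,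
    mul_comm]
  gcongr
  refine (norm_sub_le _ _).trans ?_
  rw [Real.norm_eq_abs, Real.norm_eq_abs, abs_mul, abs_of_pos hp]
  linarith [mul_le_of_le_one_right hp.le (abs_triangleWave_le_one (v / (Real.pi * T)))]

theorem hasMellinDeriv_mellinTransform (hf : MemM2 c f)
    (hv : Integrable fun v : ℝ => (v : ℂ) * mellinTransform c f v) {x : ℝ} (hx : 0 < x) :
    HasMellinDeriv c f x (1 / (2 * (Real.pi : ℂ)) * ∫ v : ℝ,
      (-Complex.I * (v * mellinTransform c f v)) * (x : ℂ) ^ (-(c : ℂ) - Complex.I * (v : ℂ))) :=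
  hasMellinDeriv_of_represents (represents_mellinTransform hf.1 hf.2.1 hf.2.2) hv hx

theorem represents_mellinDeriv (hf : MemM2 c f)
    (hv : Integrable fun v : ℝ => (v : ℂ) * mellinTransform c f v) :
    Represents 1 c (mellinDeriv c f) fun v => -Complex.I * (v * mellinTransform c f v) :=
  ⟨hv.const_mul _, memLp_one_iff_integrable.2 (hv.const_mul _), fun _ hx =>
    (hasMellinDeriv_mellinTransform hf hv hx).limUnder_eq⟩

theorem boasRemainder_eq_integral (hf : MemM2 c f)
    (hv : Integrable fun v : ℝ => (v : ℂ) * mellinTransform c f v) (hT : 0 < T) {x : ℝ}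
    (hx : 0 < x) :
    boasRemainder c T f x = 1 / (2 * (Real.pi : ℂ) * Complex.I) *
      ∫ v : ℝ, remainderIntegrand c T f x v := by
  have hpi : (Real.pi : ℂ) ≠ 0 := by exact_mod_cast Real.pi_ne_zero
  have hr := represents_mellinTransform hf.1 hf.2.1 hf.2.2
  rw [boasRemainder, (represents_mellinDeriv hf hv).2.2 x hx, (hasSum_boasTerm hT hr hx).tsum_eq,
    funext (remainderIntegrand_eq c T f x), integral_sub (integrable_mul_cpow hx hv)
    ((integrable_triangleWave_mul T (integrable_mul_cpow hx hf.2.2)).const_mul _)]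
  -- What remains is `(4T/π)(π²/4) = πT` and `-i = 1/i`.
  simp only [mul_assoc, integral_const_mul]
  push_cast
  rw [one_div (2 * ((Real.pi : ℂ) * Complex.I)), mul_inv, mul_inv, Complex.inv_I]
  field_simp
  ring

theorem boasRemainder_eq_setIntegral (hf : MemM2 c f)
    (hv : Integrable fun v : ℝ => (v : ℂ) * mellinTransform c f v) (hT : 0 < T) {x : ℝ}
    (hx : 0 < x) :
    boasRemainder c T f x = 1 / (2 * (Real.pi : ℂ) * Complex.I) *
      ∫ v in {v : ℝ | Real.pi * T ≤ |v|}, remainderIntegrand c T f x v := by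
  rw [boasRemainder_eq_integral hf hv hT hx, setIntegral_eq_integral_of_forall_compl_eq_zero]
  exact fun v hv' => remainderIntegrand_eq_zero hT x (not_le.1 hv').le

theorem integrable_abs_add_mul_norm (hi : Integrable (mellinTransform c f))
    (hv : Integrable fun v : ℝ => (v : ℂ) * mellinTransform c f v) (T : ℝ) :
    Integrable fun v : ℝ => (|v| + Real.pi * T) * ‖mellinTransform c f v‖ := by
  simp only [add_mul]
  refine Integrable.add ?_ (hi.norm.const_mul _)
  simpa using hv.norm

theorem norm_one_div_two_pi_I : ‖1 / (2 * (Real.pi : ℂ) * Complex.I)‖ = 1 / (2 * Real.pi) := by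
  simp [abs_of_pos Real.pi_pos]

theorem norm_boasRemainder_le (hf : MemM2 c f)
    (hv : Integrable fun v : ℝ => (v : ℂ) * mellinTransform c f v) (hT : 0 < T) {x : ℝ}
    (hx : 0 < x) :
    ‖boasRemainder c T f x‖ ≤ x ^ (-c) / (2 * Real.pi) *
      ∫ v in {v : ℝ | Real.pi * T ≤ |v|}, (|v| + Real.pi * T) * ‖mellinTransform c f v‖ := by
  rw [boasRemainder_eq_setIntegral hf hv hT hx, norm_mul, norm_one_div_two_pi_I,
    div_eq_mul_one_div (x ^ (-c)), mul_comm (x ^ (-c)), mul_assoc, ← integral_const_mul]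
  gcongr
  exact norm_integral_le_of_norm_le
    ((integrable_abs_add_mul_norm hf.2.2 hv T).integrableOn.const_mul _)
    (Eventually.of_forall fun v => norm_remainderIntegrand_le hT hx v)

theorem normXInfty_boasRemainder_le (hf : MemM2 c f)
    (hv : Integrable fun v : ℝ => (v : ℂ) * mellinTransform c f v) (hT : 0 < T) :
    normXInfty c (boasRemainder c T f) ≤
      ENNReal.ofReal (1 / Real.pi) * distB2 1 c (Real.pi * T) (mellinDeriv c f) := by
  refine le_trans ?_ (mul_le_mul_right
    (setLIntegral_enorm_le_distB2 (represents_mellinDeriv hf hv)) _)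
  refine iSup_le fun ⟨x, hx⟩ => ?_
  have hx : 0 < x := hx
  have hm : MeasurableSet {v : ℝ | Real.pi * T < |v|} :=
    measurableSet_lt measurable_const measurable_norm
  -- Here `|v| + πT ≤ 2|v|`; this `2` turns `1/(2π)` into `1/π`. The strict inequality, matching
  -- `MemB2`, loses nothing, as the integrand vanishes at `|v| = πT`.
  have hb : ∀ v, ‖remainderIntegrand c T f x v‖ₑ ≤ {v : ℝ | Real.pi * T < |v|}.indicator
      (fun v => ENNReal.ofReal (2 * x ^ (-c)) * ‖-Complex.I * (v * mellinTransform c f v)‖ₑ) v := by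
    intro v
    by_cases h : Real.pi * T < |v|
    · rw [Set.indicator_of_mem (by exact h), ← ofReal_norm, ← ofReal_norm,
        ← ENNReal.ofReal_mul (by positivity)]
      refine ENNReal.ofReal_le_ofReal ((norm_remainderIntegrand_le hT hx v).trans ?_)
      rw [norm_mul, norm_neg, Complex.norm_I, one_mul, norm_mul, Complex.norm_real,
        Real.norm_eq_abs, mul_comm 2, mul_assoc, ← mul_assoc 2]
      gcongr
      linarith
    · rw [remainderIntegrand_eq_zero hT x (not_lt.1 h)]
      simp
  have hint : ‖∫ v, remainderIntegrand c T f x v‖ₑ ≤ ENNReal.ofReal (2 * x ^ (-c)) *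
      ∫⁻ v in {v : ℝ | Real.pi * T < |v|}, ‖-Complex.I * (v * mellinTransform c f v)‖ₑ := by
    refine (enorm_integral_le_lintegral_enorm _).trans ((lintegral_mono hb).trans ?_)
    rw [lintegral_indicator hm, lintegral_const_mul' _ _ ENNReal.ofReal_ne_top]
  rw [boasRemainder_eq_integral hf hv hT hx, enorm_mul, enorm_mul]
  refine (mul_le_mul_right (mul_le_mul_right hint _) _).trans (le_of_eq ?_)
  rw [← mul_assoc, ← mul_assoc]
  congr 1
  rw [← ofReal_norm, ← ofReal_norm, norm_one_div_two_pi_I, Complex.norm_real,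
    Real.norm_of_nonneg (by positivity), ← ENNReal.ofReal_mul (by positivity),
    ← ENNReal.ofReal_mul (by positivity)]
  congr 1
  have e : x ^ c * x ^ (-c) = 1 := by
    rw [← Real.rpow_add hx]
    simp
  have := Real.pi_ne_zero
  field_simp
  linear_combination e

end Remainder

theorem theorem10 (c : ℝ) (f : ℝ → ℂ) (hf : MemM2 c f)
    (hv : Integrable (fun v : ℝ => (v : ℂ) * mellinTransform c f v)) (T : ℝ) (hT : 0 < T) :
    (∀ x : ℝ, 0 < x →
      HasMellinDeriv c f x (mellinDeriv c f x) ∧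
      Summable (boasTerm c T f x) ∧
      mellinDeriv c f x =
        ((4 * T / Real.pi : ℝ) : ℂ) * (∑' k : ℤ, boasTerm c T f x k) + boasRemainder c T f x ∧
      IntegrableOn (remainderIntegrand c T f x) {v : ℝ | Real.pi * T ≤ |v|} ∧
      boasRemainder c T f x =
        1 / (2 * (Real.pi : ℂ) * Complex.I) *
          ∫ v in {v : ℝ | Real.pi * T ≤ |v|}, remainderIntegrand c T f x v ∧
      IntegrableOn (fun v : ℝ => (|v| + Real.pi * T) * ‖mellinTransform c f v‖)
        {v : ℝ | Real.pi * T ≤ |v|} ∧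
      ‖boasRemainder c T f x‖ ≤
        x ^ (-c) / (2 * Real.pi) *
          ∫ v in {v : ℝ | Real.pi * T ≤ |v|},
            (|v| + Real.pi * T) * ‖mellinTransform c f v‖) ∧
    MemG 1 c (mellinDeriv c f) ∧
    distB2 1 c (Real.pi * T) (mellinDeriv c f) < ⊤ ∧
    normXInfty c (boasRemainder c T f) ≤
      ENNReal.ofReal (1 / Real.pi) * distB2 1 c (Real.pi * T) (mellinDeriv c f) := by
  have hr := represents_mellinTransform hf.1 hf.2.1 hf.2.2
  have hd := represents_mellinDeriv hf hv
  refine ⟨fun x hx => ⟨?_, (hasSum_boasTerm hT hr hx).summable, by rw [boasRemainder]; ring,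
    (integrable_remainderIntegrand hf.2.2 hv T hx).integrableOn,
    boasRemainder_eq_setIntegral hf hv hT hx,
    (integrable_abs_add_mul_norm hf.2.2 hv T).integrableOn, norm_boasRemainder_le hf hv hT hx⟩,
    ⟨_, hd⟩, ?_, normXInfty_boasRemainder_le hf hv hT⟩
  · rw [hd.2.2 x hx]
    exact hasMellinDeriv_mellinTransform hf hv hx
  · refine lt_of_le_of_lt (iInf₂_le 0 (memB2_zero c _)) ?_
    rw [sub_zero]
    exact lt_of_le_of_lt (iInf₂_le _ hd) hd.2.1.2
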